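/- Let $(M,c)$ be a smooth manifold of dimension $d\ge 3$ (possibly with boundary) with a conformal class $c$ of smooth pseudo-Riemannian metrics of any signature; for $g\in c$ the class consists of the metrics $e^{2\Upsilon}g$, $\Upsilon\in C^\infty(M)$. Let $\mathcal E[w]$, $w\in\mathbb C$, be the (complex) conformal density bundles (in the scale $g$ a density is a function $f_g$, with $f_{e^{2\Upsilon}g}=e^{w\Upsilon}f_g$), let $\mathcal T\stackrel{g}{\cong}\mathcal E[1]\oplus T^*M[1]\oplus\mathcal E[-1]$ be the standard tractor bundle, with change of splitting $$\widehat{(s,\mu_a,\rho)}=\bigl(s,\ \mu_a+s\Upsilon_a,\ \rho-\Upsilon^a\mu_a-\tfrac12 s\,\Upsilon^a\Upsilon_a\bigr),\qquad \Upsilon_a=\nabla_a\Upsilon,$$ tractor metric $h(T,T)=\mu^a\mu_a+2s\rho$, used to raise and lower tractor indices $A$, and tractor connection $$\nabla_a(s,\mu_b,\rho)=(\nabla_a s-\mu_a,\ \nabla_a\mu_b+g_{ab}\rho+P_{ab}s,\ \nabla_a\rho-P_{ab}\mu^b),$$ where $P_{ab}$ is the Schouten tensor, $\mathrm{Ric}_{ab}=(d-2)P_{ab}+Jg_{ab}$,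 $J=P^a{}_a$. Let $\mathbf w$ be the weight operator, induced by the Euler operator $t\,\partial_t$ of the bundle of metrics $t^2g$ (tractor indices being of weight $0$): it is multiplication by $w$ on sections of $\mathcal E^\Phi[w]=\mathcal E^\Phi\otimes\mathcal E[w]$, for any tractor bundle $\mathcal E^\Phi$ (a tensor power of $\mathcal T$ or a tensor part of one), it obeys the Leibniz rule for products with densities and log densities, and $\mathbf w\log\sigma=1$ for $0<\sigma\in\Gamma\mathcal E[1]$, so that $\mathbf w(\log\sigma\, f)=w\log\sigma\, f+f$ for $f\in\Gamma\mathcal E^\Phi[w]$. Let $D_A$ be the Thomas-D operator, in a scale $g\in c$ $$D_AV=\bigl((d+2\mathbf w-2)\mathbf wV,\ (d+2\mathbf w-2)\nabla_aV,\ -(\Delta+J\mathbf w)V\bigr),\qquad \Delta=g^{ab}\nabla_a\nabla_b ,$$ with $\nabla$ the coupled Levi-Civita-tractor connection. Let $\sigma$ be a smooth real section of $\mathcal E[1]$, let $I_A=\frac1d D_A\sigma$ be its scale tractor, $I^2=I^AI_A$ and $I\cdot D=I^AD_A$, and suppose that $I^2$ is nowhere vanishing on $M$. Put $x=\sigma$,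 $y=-\frac1{I^2}\,I\cdot D$ and $h=d+2\mathbf w$. Then, on every open set $U\subseteq M$ on which $\sigma>0$, and for every tractor bundle $\mathcal E^\Phi$, every $w\in\mathbb C$ and every smooth section $f$ of $\mathcal E^\Phi[w]$ over $U$, $$[y,\log x]\,f=-x^{-1}(h-1)f ,$$ that is, $y(\log\sigma\, f)-\log\sigma\; y f=-(d+2w-1)\,\sigma^{-1}f$ on $U$. -/

import Mathlib

open scoped Manifold ContDiff Topology

noncomputable section

namespace ConformalTractor

/-! ### Linear algebra of the fibres -/

/-- The model space of a `d`-dimensional manifold. -/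
abbrev Coord (d : ℕ) : Type := EuclideanSpace ℝ (Fin d)

/-- The `i`-th coordinate vector. -/
def coordVec {d : ℕ} (i : Fin d) : Coord d := EuclideanSpace.single i 1

/-- The fibre of the dual `𝓔[-1] ⊕ TM[-1] ⊕ 𝓔[1]` of the standard tractor bundle
`𝓣 = 𝓔[1] ⊕ T*M[1] ⊕ 𝓔[-1]`, in the splitting given by a metric `g` of the conformal class and with
densities trivialised by `g`. A dual tractor `(a, v, b)` pairs with a tractor `(s, μ, ρ)` to
`a s + μ(v) + b ρ`. (In Mathlib the tangent space at every point is a copy of the model space.) -/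
abbrev DualTractor (d : ℕ) : Type := ℝ × Coord d × ℝ

/-- The fibre of the (complexified) tensor power `⊗ᵏ 𝓣`, as `k`-linear forms on dual tractors. -/
abbrev TractorTensor (d k : ℕ) : Type := DualTractor d [×k]→L[ℝ] ℂ

/-- The three slots of an element of `𝓣 ⊗ W ≅ W ⊕ (T*M ⊗ W) ⊕ W` in a scale; the middle slot is
given by its components. -/
structure Slots (d : ℕ) (W : Type*) where
  top : W
  mid : Fin d → W
  bot : W

/-- Tensorial action on `⊗ᵏ 𝓣` of an endomorphism of `𝓣`, given through its transpose `B`: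
`(α₁, …, αₖ) ↦ ∑ⱼ V(α₁, …, B αⱼ, …, αₖ)`. -/
def tensorAct {d k : ℕ} (B : DualTractor d →L[ℝ] DualTractor d) (V : TractorTensor d k) :
    TractorTensor d k :=
  ∑ j : Fin k, V.compContinuousLinearMap
    (Function.update (fun _ => ContinuousLinearMap.id ℝ (DualTractor d)) j B)

/-! ### Pseudo-Riemannian geometry and the tractor connection in coordinates

`S` is the coordinate domain (a relatively open subset of a half space or of the whole space) and
`G` the matrix of components of the metric. -/

section Coordinates

variable {d : ℕ} (S : Set (Coord d)) (G : Coord d → Matrix (Fin d) (Fin d) ℝ)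

/-- The partial derivative `∂ᵢ u`. -/
def pd {F : Type*} [NormedAddCommGroup F] [NormedSpace ℝ F] (u : Coord d → F) (i : Fin d)
    (x : Coord d) : F :=
  fderivWithin ℝ u S x (coordVec i)

/-- The Christoffel symbol `Γᵏᵢⱼ` of the Levi-Civita connection. -/
def christoffel (k i j : Fin d) (x : Coord d) : ℝ :=
  (1 / 2) * ∑ l, (G x)⁻¹ k l *
    (pd S (fun z => G z j l) i x + pd S (fun z => G z i l) j x - pd S (fun z => G z i j) l x)

/-- The curvature `Rᵢⱼᵏₗ`, that is `R(∂ᵢ, ∂ⱼ) ∂ₗ = Rᵢⱼᵏₗ ∂ₖ` for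
`R(X,Y)Z = ∇_X ∇_Y Z - ∇_Y ∇_X Z - ∇_[X,Y] Z`. -/
def riemann (i j k l : Fin d) (x : Coord d) : ℝ :=
  pd S (christoffel S G k j l) i x - pd S (christoffel S G k i l) j x
    + ∑ m, (christoffel S G k i m x * christoffel S G m j l x
      - christoffel S G k j m x * christoffel S G m i l x)

/-- The Ricci tensor `Ricᵢⱼ = Rₖᵢᵏⱼ`. -/
def ricci (i j : Fin d) (x : Coord d) : ℝ := ∑ k, riemann S G k i k j x

/-- The trace `J` of the Schouten tensor, `J = Sc / (2 (d - 1))`. -/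
def schoutenTrace (x : Coord d) : ℝ :=
  (∑ i, ∑ j, (G x)⁻¹ i j * ricci S G i j x) / (2 * ((d : ℝ) - 1))

/-- The Schouten tensor `P`, given by `Ric = (d - 2) P + J g`. -/
def schouten (i j : Fin d) (x : Coord d) : ℝ :=
  (ricci S G i j x - schoutenTrace S G x * G x i j) / ((d : ℝ) - 2)

/-- The connection form of the tractor connection in the direction `∂ᵢ`, transposed to an
endomorphism of the dual tractor fibre. On a tractor `T = (s, μ, ρ)` it gives
`(T ∘ B)(a, v, b) = a (-μᵢ) + vʲ (-Γᵏᵢⱼ μₖ + gᵢⱼ ρ + Pᵢⱼ s) + b (-Pᵢⱼ gʲᵏ μₖ)`, so `∂ᵢ T + T ∘ B` is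
`(∇ᵢ s - μᵢ, ∇ᵢ μⱼ + gᵢⱼ ρ + Pᵢⱼ s, ∇ᵢ ρ - Pᵢⱼ μʲ)`. -/
def tractorForm (i : Fin d) (x : Coord d) : DualTractor d →L[ℝ] DualTractor d :=
  LinearMap.toContinuousLinearMap
    { toFun := fun α =>
        (∑ j, schouten S G i j x * α.2.1 j,
          - α.1 • coordVec i
            - ∑ k, (∑ j, christoffel S G k i j x * α.2.1 j) • coordVec k
            - α.2.2 • ∑ k, (∑ j, schouten S G i j x * (G x)⁻¹ j k) • coordVec k,
          ∑ j, G x i j * α.2.1 j)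
      map_add' := by
        intro α β
        refine Prod.ext ?_ (Prod.ext ?_ ?_)
        · simp [mul_add, Finset.sum_add_distrib]
        · simp only [Prod.snd_add, Prod.fst_add, PiLp.add_apply, mul_add, Finset.sum_add_distrib,
            add_smul, neg_add]
          abel
        · simp [mul_add, Finset.sum_add_distrib]
      map_smul' := by
        intro r α
        refine Prod.ext ?_ (Prod.ext ?_ ?_)
        · simp [Finset.mul_sum, mul_left_comm]
        · simp only [Prod.smul_snd, Prod.smul_fst, PiLp.smul_apply, smul_eq_mul,
            mul_left_comm _ r, ← Finset.mul_sum, mul_smul, smul_sub, Finset.smul_sum,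
            RingHom.id_apply, neg_smul, smul_neg]
        · simp [Finset.mul_sum, mul_left_comm] }

/-- The covariant derivative `∇ᵢ V` of a section of `⊗ᵏ 𝓣 ⊗ 𝓔[w]`, the densities being trivialised
by the metric. -/
def nabla {k : ℕ} (V : Coord d → TractorTensor d k) (i : Fin d) (x : Coord d) : TractorTensor d k :=
  pd S V i x + tensorAct (tractorForm S G i x) (V x)

/-- The Laplacian `Δ V = gⁱʲ ∇ᵢ ∇ⱼ V` of the coupled Levi-Civita-tractor connection. -/
def laplacian {k : ℕ} (V : Coord d → TractorTensor d k) (x : Coord d) : TractorTensor d k :=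
  ∑ i, ∑ j, (G x)⁻¹ i j •
    (nabla S G (nabla S G V j) i x - ∑ m, christoffel S G m i j x • nabla S G V m x)

end Coordinates

/-! ### Metrics, conformal classes and weighted tractors on a manifold -/

variable {d : ℕ} {H : Type*} [TopologicalSpace H] (I : ModelWithCorners ℝ (Coord d) H)
  (M : Type*) [TopologicalSpace M] [ChartedSpace H M] [IsManifold I ∞ M]

variable {M} in
/-- The derivative at `q` of the change from the preferred chart at `p` to the one at `q`. It sends
the components of a tangent vector at `q` in the chart at `p` to the vector itself. -/
def fromChart (p q : M) : Coord d →L[ℝ] TangentSpace I q := tangentCoordChange I p q q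

variable {M} in
/-- The components, in the preferred chart at `p`, of a field of bilinear forms. -/
def chartMatrix (b : ∀ q : M, TangentSpace I q →L[ℝ] TangentSpace I q →L[ℝ] ℝ) (p : M)
    (x : Coord d) : Matrix (Fin d) (Fin d) ℝ :=
  Matrix.of fun i j =>
    b ((extChartAt I p).symm x)
      (fromChart I p ((extChartAt I p).symm x) (coordVec i))
      (fromChart I p ((extChartAt I p).symm x) (coordVec j))

variable {M} in
/-- The expression, in the preferred chart at `p`, of a field with values in `⊗ᵏ 𝓣` (in a scale). -/
def chartField {k : ℕ} (v : M → TractorTensor d k) (p : M) (x : Coord d) : TractorTensor d k :=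
  (v ((extChartAt I p).symm x)).compContinuousLinearMap fun _ =>
    (ContinuousLinearMap.id ℝ ℝ).prodMap
      (ContinuousLinearMap.prodMap (fromChart I p ((extChartAt I p).symm x))
        (ContinuousLinearMap.id ℝ ℝ))

/-- A smooth pseudo-Riemannian metric, of any signature. -/
@[ext]
structure PseudoMetric where
  val : ∀ p : M, TangentSpace I p →L[ℝ] TangentSpace I p →L[ℝ] ℝ
  symm : ∀ p u v, val p u v = val p v u
  nondegenerate : ∀ p u, (∀ v, val p u v = 0) → u = 0
  smooth : ∀ p i j, ContDiffOn ℝ ∞ (fun x => chartMatrix I val p x i j) (extChartAt I p).target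

variable {I M}

namespace PseudoMetric

/-- The conformally related metric `e^{2Υ} g`. -/
def rescale (g : PseudoMetric I M) (Υ : C^∞⟮I, M; 𝓘(ℝ), ℝ⟯) : PseudoMetric I M where
  val p := Real.exp (2 * Υ p) • g.val p
  symm p u v := by simp [g.symm p u v]
  nondegenerate p u h := by
    refine g.nondegenerate p u fun v => ?_
    have := h v
    simpa [Real.exp_ne_zero] using this
  smooth p i j := by
    have h1 : ContDiffOn ℝ ∞ (fun x => Υ ((extChartAt I p).symm x)) (extChartAt I p).target := by
      rw [← contMDiffOn_iff_contDiffOn]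
      exact Υ.contMDiff.comp_contMDiffOn (contMDiffOn_extChartAt_symm p)
    exact ((contDiffOn_const.mul h1).exp).mul (g.smooth p i j)

/-- The conformal class `c = [g]`. -/
def conformalClass (g : PseudoMetric I M) : Set (PseudoMetric I M) :=
  {g' | ∃ Υ : C^∞⟮I, M; 𝓘(ℝ), ℝ⟯, g' = g.rescale Υ}

/-- The matrix of components of the metric at `p`. -/
def gram (g : PseudoMetric I M) (p : M) : Matrix (Fin d) (Fin d) ℝ :=
  Matrix.of fun i j => g.val p (coordVec i : Coord d) (coordVec j : Coord d)

/-- The differential `dΥ` at `p`. -/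
def differential (Υ : C^∞⟮I, M; 𝓘(ℝ), ℝ⟯) (p : M) : Coord d →L[ℝ] ℝ := mfderiv I 𝓘(ℝ) Υ p

/-- The gradient `g^{ab} Υ_a` at `p`. -/
def gradient (g : PseudoMetric I M) (Υ : C^∞⟮I, M; 𝓘(ℝ), ℝ⟯) (p : M) : Coord d :=
  ∑ i, ∑ j, ((g.gram p)⁻¹ i j * differential Υ p (coordVec i)) • coordVec j

/-- The change of splitting from `g` to `e^{2Υ} g`, transposed to a map of dual tractors (from the
splitting of `e^{2Υ} g` to that of `g`). With the densities trivialised by the respective metric,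
it is the transpose of
`(s, μ, ρ) ↦ (e^Υ s, e^Υ (μ + s dΥ), e^{-Υ} (ρ - g⁻¹(dΥ, μ) - s g⁻¹(dΥ, dΥ) / 2))`. -/
def dualChange (g : PseudoMetric I M) (Υ : C^∞⟮I, M; 𝓘(ℝ), ℝ⟯) (p : M) :
    DualTractor d →L[ℝ] DualTractor d :=
  let dΥ : Coord d →L[ℝ] ℝ := differential Υ p
  let n : Coord d := g.gradient Υ p
  LinearMap.toContinuousLinearMap
    { toFun := fun α =>
        (Real.exp (Υ p) * (α.1 + dΥ α.2.1) - Real.exp (-Υ p) * α.2.2 * dΥ n / 2,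
          Real.exp (Υ p) • α.2.1 - (Real.exp (-Υ p) * α.2.2) • n,
          Real.exp (-Υ p) * α.2.2)
      map_add' := by
        intro α β
        refine Prod.ext ?_ (Prod.ext ?_ ?_)
        · simp only [Prod.fst_add, Prod.snd_add, map_add]; ring
        · simp only [Prod.fst_add, Prod.snd_add, mul_add, add_smul, smul_add]; abel
        · simp only [Prod.snd_add]; ring
      map_smul' := by
        intro r α
        refine Prod.ext ?_ (Prod.ext ?_ ?_)
        · simp only [Prod.smul_fst, Prod.smul_snd, map_smul, smul_eq_mul, RingHom.id_apply]; ring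
        · simp only [Prod.smul_fst, Prod.smul_snd, smul_eq_mul, RingHom.id_apply, smul_sub,
            smul_smul]
          congr 2 <;> ring
        · simp only [Prod.smul_snd, smul_eq_mul, RingHom.id_apply]; ring }

/-- The induced change of splitting of `⊗ᵏ 𝓣`, from `g` to `e^{2Υ} g`. -/
def changeSplitting {k : ℕ} (g : PseudoMetric I M) (Υ : C^∞⟮I, M; 𝓘(ℝ), ℝ⟯) (p : M)
    (t : TractorTensor d k) : TractorTensor d k :=
  t.compContinuousLinearMap fun _ => g.dualChange Υ p

end PseudoMetric

variable (I M) in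
/-- A tractor-valued function on the bundle of conformally related metrics, as the family of its
expressions in the scales `g`. Weighted tractors and their products with log densities are
particular such families; all operators act on families. -/
abbrev Family (k : ℕ) : Type _ := PseudoMetric I M → M → TractorTensor d k

variable (I M) in
/-- A real-valued function on the bundle of conformally related metrics. -/
abbrev RealFamily : Type _ := PseudoMetric I M → M → ℝ

/-- `σ` is a smooth real section over `M` of the density bundle `𝓔[1]` of the conformal
structure `c`. -/
structure IsScale (c : Set (PseudoMetric I M)) (σ : RealFamily I M) : Prop where
  smooth : ∀ g ∈ c, ContMDiff I 𝓘(ℝ) ∞ (σ g)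
  equivariant : ∀ g ∈ c, ∀ (Υ : C^∞⟮I, M; 𝓘(ℝ), ℝ⟯) (p : M),
    σ (g.rescale Υ) p = Real.exp (Υ p) * σ g p

/-- `f` is a smooth section over `U` of the weighted tractor bundle `⊗ᵏ 𝓣 ⊗ 𝓔[w]` of the conformal
structure `c`. -/
structure IsWeightedTractor {k : ℕ} (c : Set (PseudoMetric I M)) (w : ℂ) (U : Set M)
    (f : Family I M k) : Prop where
  smooth : ∀ g ∈ c, ∀ p : M, ContDiffOn ℝ ∞ (chartField I (f g) p)
    ((extChartAt I p).target ∩ (extChartAt I p).symm ⁻¹' U)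
  equivariant : ∀ g ∈ c, ∀ (Υ : C^∞⟮I, M; 𝓘(ℝ), ℝ⟯), ∀ p ∈ U,
    f (g.rescale Υ) p = Complex.exp (w * Υ p) • g.changeSplitting Υ p (f g p)

/-! ### Operators -/

variable {k : ℕ}

/-- The weight operator: the Euler operator of the bundle of conformally related metrics, which is
the derivative at `s = 0` along `s ↦ e^{2s} g`, with the values of the family brought back to the
splitting of `g`. -/
def weightOp (V : Family I M k) : Family I M k := fun g p =>
  deriv (fun s : ℝ =>
    (g.rescale (ContMDiffMap.const s)).changeSplitting (ContMDiffMap.const (-s)) p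
      (V (g.rescale (ContMDiffMap.const s)) p)) 0

/-- The coupled covariant derivative `∇ᵢ V` in the scale `g`, at `p`. -/
def covDeriv (V : Family I M k) (g : PseudoMetric I M) (p : M) (i : Fin d) : TractorTensor d k :=
  nabla (extChartAt I p).target (chartMatrix I g.val p) (chartField I (V g) p) i (extChartAt I p p)

/-- The coupled Laplacian `Δ V` in the scale `g`. -/
def boxOp (V : Family I M k) : Family I M k := fun g p =>
  laplacian (extChartAt I p).target (chartMatrix I g.val p) (chartField I (V g) p) (extChartAt I p p)

/-- The trace `J` of the Schouten tensor, as a function of the scale `g`. -/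
def traceJ : RealFamily I M := fun g p =>
  schoutenTrace (extChartAt I p).target (chartMatrix I g.val p) (extChartAt I p p)

/-- The operator `h = d + 2 𝐰`. -/
def hOp (V : Family I M k) : Family I M k := (d : ℂ) • V + (2 : ℂ) • weightOp V

/-- The Thomas-D operator
`D_A V = ((d + 2𝐰 - 2) 𝐰 V, (d + 2𝐰 - 2) ∇ V, -(Δ + J 𝐰) V)` in the scale `g`, at `p`. -/
def thomasD (V : Family I M k) (g : PseudoMetric I M) (p : M) : Slots d (TractorTensor d k) where
  top := (hOp (weightOp V) - (2 : ℂ) • weightOp V) g p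
  mid := covDeriv (hOp V - (2 : ℂ) • V) g p
  bot := -(boxOp V g p + traceJ g p • weightOp V g p)

/-- A real density as a family of tractors of rank `0`. -/
def toFamily (σ : RealFamily I M) : Family I M 0 := fun g p =>
  ContinuousMultilinearMap.constOfIsEmpty ℝ (fun _ => DualTractor d) ((σ g p : ℝ) : ℂ)

/-- The scale tractor `I_A = (1/d) D_A σ` in the scale `g`, at `p`. -/
def scaleTractor (σ : RealFamily I M) (g : PseudoMetric I M) (p : M) : Slots d ℂ where
  top := (1 / (d : ℂ)) * (thomasD (toFamily σ) g p).top 0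
  mid i := (1 / (d : ℂ)) * (thomasD (toFamily σ) g p).mid i 0
  bot := (1 / (d : ℂ)) * (thomasD (toFamily σ) g p).bot 0

/-- Contraction `T^A T'_A` with the tractor metric
`h(T, T') = g⁻¹(μ, μ') + s ρ' + ρ s'` in the scale `g`, at `p`. -/
def contract {W : Type*} [AddCommGroup W] [Module ℂ W] (g : PseudoMetric I M) (p : M)
    (T : Slots d ℂ) (T' : Slots d W) : W :=
  (∑ i, ∑ j, (((g.gram p)⁻¹ i j : ℝ) : ℂ) • T.mid i • T'.mid j)
    + T.top • T'.bot + T.bot • T'.top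

/-- `I² = I^A I_A`. -/
def scaleSq (σ : RealFamily I M) (g : PseudoMetric I M) (p : M) : ℂ :=
  contract g p (scaleTractor σ g p) (scaleTractor σ g p)

/-- `I·D = I^A D_A`. -/
def iDotD (σ : RealFamily I M) (V : Family I M k) : Family I M k := fun g p =>
  contract g p (scaleTractor σ g p) (thomasD V g p)

/-- The operator `y = -(1/I²) I·D`. -/
def yOp (σ : RealFamily I M) (V : Family I M k) : Family I M k := fun g p =>
  -(1 / scaleSq σ g p) • iDotD σ V g p

/-- Multiplication by the log density `log x`, where `x = σ > 0`. -/
def logXOp (σ : RealFamily I M) (V : Family I M k) : Family I M k := fun g p =>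
  Real.log (σ g p) • V g p

/-- Multiplication by `x⁻¹`, where `x = σ ≠ 0`. -/
def xInvOp (σ : RealFamily I M) (V : Family I M k) : Family I M k := fun g p =>
  (σ g p)⁻¹ • V g p

/-- The commutator of two operators on families. -/
def commutator (A B : Family I M k → Family I M k) (V : Family I M k) : Family I M k :=
  A (B V) - B (A V)

end ConformalTractor

end

open scoped Manifold ContDiff Topology

noncomputable section

namespace ConformalTractor

/-! ### Smoothness of the geometric quantities in coordinates -/

section Smoothness

variable {d : ℕ} {S : Set (Coord d)} {G : Coord d → Matrix (Fin d) (Fin d) ℝ}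

/-! Everything is computed at one point in one scale. Write `L = log σ`. The product rules are `𝐰(L
f) = w L f + f`, `∇(L f) = L ∇f + σ⁻¹ dσ f` and `Δ(L f) = L Δf + 2σ⁻¹⟨dσ, ∇f⟩ + (σ⁻¹Δσ - σ⁻²|dσ|²)
f`. So `D(L f) - L D f` has top slot `(d + 4w - 2) f`, middle slot `(d + 2w - 2) σ⁻¹ dσ f + 2∇f`,
and bottom slot `-(σ⁻¹Δσ - σ⁻²|dσ|² + J) f - 2σ⁻¹⟨dσ, ∇f⟩`. On contraction with `I = (σ, dσ, -(Δσ +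
Jσ)/d)` the terms in `∇f` cancel, and the rest is `(d + 2w - 1) σ⁻¹ (|dσ|² - (2/d) σ (Δσ + Jσ)) f =
(d + 2w - 1) σ⁻¹ I² f`. Division by `-I²` gives the commutator.

The product rules are `weightOp_log_smul`, `nabla_smul`, `laplacian_smul` and `scalarLaplacian_log`,
assembled in `thomasD_logXOp`; `scaleTractor_eq` computes `I`, and `contract_sub_log_smul_contract`
is the cancellation. No curvature identity is needed, and equivariance within `c` enters only along
constant rescalings, to evaluate `𝐰`. -/

lemma contDiffOn_det {n : WithTop ℕ∞} {A : Coord d → Matrix (Fin d) (Fin d) ℝ}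
    (hA : ∀ i j, ContDiffOn ℝ n (fun x => A x i j) S) :
    ContDiffOn ℝ n (fun x => (A x).det) S := by
  simp only [Matrix.det_apply, Units.smul_def, zsmul_eq_mul]
  exact ContDiffOn.sum fun τ _ => contDiffOn_const.mul (contDiffOn_prod fun i _ => hA _ _)

/-- Cramer's rule: an entry of the adjugate is the determinant of the matrix with one row replaced
by a constant vector. -/
lemma contDiffOn_inv_apply {n : WithTop ℕ∞} (hG : ∀ i j, ContDiffOn ℝ n (fun x => G x i j) S)
    (hdet : ∀ x ∈ S, (G x).det ≠ 0) (i j : Fin d) :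
    ContDiffOn ℝ n (fun x => (G x)⁻¹ i j) S := by
  simp only [Matrix.inv_def, Matrix.smul_apply, Ring.inverse_eq_inv', smul_eq_mul,
    Matrix.adjugate_apply]
  refine ((contDiffOn_det hG).inv hdet).mul (contDiffOn_det fun a b => ?_)
  by_cases h : a = j
  · subst h
    simpa using contDiffOn_const
  · simpa [Matrix.updateRow_ne h] using hG a b

variable {F : Type*} [NormedAddCommGroup F] [NormedSpace ℝ F]

lemma ContDiffWithinAt.pd {u : Coord d → F} {x : Coord d} (hS : UniqueDiffOn ℝ S) (hx : x ∈ S)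
    (hu : ContDiffWithinAt ℝ ∞ u S x) (i : Fin d) : ContDiffWithinAt ℝ ∞ (pd S u i) S x :=
  (hu.fderivWithin_right hS (by simp) hx).clm_apply contDiffWithinAt_const

lemma ContDiffOn.pd {u : Coord d → F} (hS : UniqueDiffOn ℝ S)
    (hu : ContDiffOn ℝ ∞ u S) (i : Fin d) : ContDiffOn ℝ ∞ (pd S u i) S :=
  fun x hx => ContDiffWithinAt.pd hS hx (hu x hx) i

variable (hS : UniqueDiffOn ℝ S) (hG : ∀ i j, ContDiffOn ℝ ∞ (fun x => G x i j) S)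
  (hdet : ∀ x ∈ S, (G x).det ≠ 0)
include hS hG hdet

lemma contDiffOn_christoffel (k i j : Fin d) : ContDiffOn ℝ ∞ (christoffel S G k i j) S := by
  refine contDiffOn_const.mul (ContDiffOn.sum fun l _ => ?_)
  exact (contDiffOn_inv_apply hG hdet k l).mul
    (((ContDiffOn.pd hS (hG j l) i).add (ContDiffOn.pd hS (hG i l) j)).sub
      (ContDiffOn.pd hS (hG i j) l))

lemma contDiffOn_riemann (i j k l : Fin d) : ContDiffOn ℝ ∞ (riemann S G i j k l) S := by
  have hΓ := contDiffOn_christoffel hS hG hdet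
  exact ((ContDiffOn.pd hS (hΓ k j l) i).sub (ContDiffOn.pd hS (hΓ k i l) j)).add
    (ContDiffOn.sum fun m _ => ((hΓ k i m).mul (hΓ m j l)).sub ((hΓ k j m).mul (hΓ m i l)))

lemma contDiffOn_ricci (i j : Fin d) : ContDiffOn ℝ ∞ (ricci S G i j) S :=
  ContDiffOn.sum fun k _ => contDiffOn_riemann hS hG hdet k i k j

lemma contDiffOn_schoutenTrace : ContDiffOn ℝ ∞ (schoutenTrace S G) S :=
  (ContDiffOn.sum fun i _ => ContDiffOn.sum fun j _ =>
    (contDiffOn_inv_apply hG hdet i j).mul (contDiffOn_ricci hS hG hdet i j)).div_const _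

lemma contDiffOn_schouten (i j : Fin d) : ContDiffOn ℝ ∞ (schouten S G i j) S :=
  ((contDiffOn_ricci hS hG hdet i j).sub
    ((contDiffOn_schoutenTrace hS hG hdet).mul (hG i j))).div_const _

/-- The smoothness of the curvature quantities above serves only this: with a smooth connection
form, `∇V` can be differentiated once more in the Laplacian. -/
lemma contDiffOn_tractorForm (i : Fin d) : ContDiffOn ℝ ∞ (tractorForm S G i) S := by
  have hP := contDiffOn_schouten hS hG hdet
  have hΓ := contDiffOn_christoffel hS hG hdet
  have hinv := contDiffOn_inv_apply hG hdet
  refine contDiffOn_clm_apply.2 fun α => ?_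
  change ContDiffOn ℝ ∞ (fun x => (∑ j, schouten S G i j x * α.2.1 j,
          - α.1 • coordVec i
            - ∑ k, (∑ j, christoffel S G k i j x * α.2.1 j) • coordVec k
            - α.2.2 • ∑ k, (∑ j, schouten S G i j x * (G x)⁻¹ j k) • coordVec k,
          ∑ j, G x i j * α.2.1 j)) S
  refine ContDiffOn.prodMk ?_ (ContDiffOn.prodMk ?_ ?_)
  · exact ContDiffOn.sum fun j _ => (hP i j).mul contDiffOn_const
  · refine (contDiffOn_const.sub ?_).sub (ContDiffOn.const_smul α.2.2 ?_)
    · exact ContDiffOn.sum fun k _ => ContDiffOn.smul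
        (ContDiffOn.sum fun j _ => (hΓ k i j).mul contDiffOn_const) contDiffOn_const
    · exact ContDiffOn.sum fun k _ => ContDiffOn.smul
        (ContDiffOn.sum fun j _ => (hP i j).mul (hinv j k)) contDiffOn_const
  · exact ContDiffOn.sum fun j _ => (hG i j).mul contDiffOn_const

end Smoothness

/-! ### Leibniz rules in coordinates -/

section Leibniz

variable {d k : ℕ}

lemma tensorAct_add (B : DualTractor d →L[ℝ] DualTractor d) (V W : TractorTensor d k) :
    tensorAct B (V + W) = tensorAct B V + tensorAct B W := by
  ext; simp [tensorAct, Finset.sum_add_distrib]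

lemma tensorAct_smul {R : Type*} [Semiring R] [Module R ℂ] [SMulCommClass ℝ R ℂ]
    [ContinuousConstSMul R ℂ]
    (B : DualTractor d →L[ℝ] DualTractor d) (r : R) (V : TractorTensor d k) :
    tensorAct B (r • V) = r • tensorAct B V := by
  ext; simp [tensorAct, Finset.smul_sum]

lemma tensorAct_rank_zero (B : DualTractor d →L[ℝ] DualTractor d) (V : TractorTensor d 0) :
    tensorAct B V = 0 := by
  simp [tensorAct]

/-- Precomposition of a `k`-linear form is continuous multilinear in the `k` linear maps, hence
smooth in them, and it is linear in the form. -/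
lemma ContDiffWithinAt.tensorAct {n : WithTop ℕ∞} {S : Set (Coord d)} {x : Coord d}
    {B : Coord d → DualTractor d →L[ℝ] DualTractor d} {V : Coord d → TractorTensor d k}
    (hB : ContDiffWithinAt ℝ n B S x) (hV : ContDiffWithinAt ℝ n V S x) :
    ContDiffWithinAt ℝ n (fun z => tensorAct (B z) (V z)) S x := by
  refine ContDiffWithinAt.sum fun j _ => ?_
  let Λ := ContinuousMultilinearMap.compContinuousLinearMapContinuousMultilinear ℝ
    (fun _ : Fin k => DualTractor d) (fun _ => DualTractor d) ℂ
  have hc : ContDiffWithinAt ℝ n (fun z => Λ (Function.update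
      (fun _ => ContinuousLinearMap.id ℝ (DualTractor d)) j (B z))) S x := by
    refine (ContinuousMultilinearMap.contDiff (𝕜 := ℝ) (E := fun _ : Fin k =>
      DualTractor d →L[ℝ] DualTractor d) (F := TractorTensor d k →L[ℝ] TractorTensor d k) Λ).contDiffAt.comp_contDiffWithinAt x (contDiffWithinAt_pi.2 fun l => ?_)
    by_cases h : l = j
    · subst h; simpa using hB
    · simpa [Function.update_of_ne h] using contDiffWithinAt_const
  exact hc.clm_apply hV

variable {S : Set (Coord d)} {G : Coord d → Matrix (Fin d) (Fin d) ℝ} {x : Coord d}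

lemma ContDiffWithinAt.nabla (hS : UniqueDiffOn ℝ S)
    (hG : ∀ i j, ContDiffOn ℝ ∞ (fun x => G x i j) S) (hdet : ∀ x ∈ S, (G x).det ≠ 0)
    (hx : x ∈ S) {V : Coord d → TractorTensor d k} (hV : ContDiffWithinAt ℝ ∞ V S x) (i : Fin d) :
    ContDiffWithinAt ℝ ∞ (nabla S G V i) S x :=
  (ContDiffWithinAt.pd hS hx hV i).add
    (ContDiffWithinAt.tensorAct (contDiffOn_tractorForm hS hG hdet i x hx) hV)

/-! ### Partial derivatives within the coordinate domain. -/

section pd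

variable {F : Type*} [NormedAddCommGroup F] [NormedSpace ℝ F]

lemma pd_congr {u v : Coord d → F} (h : u =ᶠ[𝓝[S] x] v) (hx : x ∈ S) (i : Fin d) :
    pd S u i x = pd S v i x := by
  rw [pd, h.fderivWithin_eq_of_mem hx, pd]

lemma pd_add (hS : UniqueDiffWithinAt ℝ S x) {u v : Coord d → F}
    (hu : DifferentiableWithinAt ℝ u S x) (hv : DifferentiableWithinAt ℝ v S x) (i : Fin d) :
    pd S (u + v) i x = pd S u i x + pd S v i x := by
  simp [pd, fderivWithin_add hS hu hv]

lemma pd_smul (hS : UniqueDiffWithinAt ℝ S x) {s : Coord d → ℝ} {u : Coord d → F}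
    (hs : DifferentiableWithinAt ℝ s S x) (hu : DifferentiableWithinAt ℝ u S x) (i : Fin d) :
    pd S (s • u) i x = s x • pd S u i x + pd S s i x • u x := by
  simp [pd, fderivWithin_smul hS hs hu]

lemma pd_const_smul [NormedSpace ℂ F] (hS : UniqueDiffWithinAt ℝ S x)
    {u : Coord d → F} (a : ℂ) (hu : DifferentiableWithinAt ℝ u S x) (i : Fin d) :
    pd S (a • u) i x = a • pd S u i x := by
  simp [pd, fderivWithin_const_smul hS hu]

lemma pd_smul_const (hS : UniqueDiffWithinAt ℝ S x) {s : Coord d → ℝ}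
    (hs : DifferentiableWithinAt ℝ s S x) (e : F) (i : Fin d) :
    pd S (fun z => s z • e) i x = pd S s i x • e := by
  simp [pd, fderivWithin_smul_const hS hs]

lemma pd_log (hS : UniqueDiffWithinAt ℝ S x) {s : Coord d → ℝ}
    (hs : DifferentiableWithinAt ℝ s S x) (h0 : s x ≠ 0) (i : Fin d) :
    pd S (fun z => Real.log (s z)) i x = (s x)⁻¹ * pd S s i x := by
  simp [pd, fderivWithin.log hs h0 hS]

end pd

/-! ### Locality and product rules for the coupled connection and Laplacian. -/

lemma nabla_congr {V W : Coord d → TractorTensor d k} (h : V =ᶠ[𝓝[S] x] W) (hx : x ∈ S)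
    (i : Fin d) : nabla S G V i x = nabla S G W i x := by
  rw [nabla, nabla, pd_congr h hx, h.eq_of_nhdsWithin hx]

lemma nabla_add (hS : UniqueDiffWithinAt ℝ S x) {V W : Coord d → TractorTensor d k}
    (hV : DifferentiableWithinAt ℝ V S x) (hW : DifferentiableWithinAt ℝ W S x) (i : Fin d) :
    nabla S G (V + W) i x = nabla S G V i x + nabla S G W i x := by
  simp only [nabla, pd_add hS hV hW, Pi.add_apply, tensorAct_add]
  abel

lemma nabla_const_smul (hS : UniqueDiffWithinAt ℝ S x) {V : Coord d → TractorTensor d k}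
    (a : ℂ) (hV : DifferentiableWithinAt ℝ V S x) (i : Fin d) :
    nabla S G (a • V) i x = a • nabla S G V i x := by
  simp only [nabla, pd_const_smul hS a hV, Pi.smul_apply, tensorAct_smul, smul_add]

/-- The connection form acts linearly on the fibre, so only the partial derivative sees the factor
`s`. -/
lemma nabla_smul (hS : UniqueDiffWithinAt ℝ S x) {s : Coord d → ℝ}
    {V : Coord d → TractorTensor d k} (hs : DifferentiableWithinAt ℝ s S x)
    (hV : DifferentiableWithinAt ℝ V S x) (i : Fin d) :
    nabla S G (s • V) i x = s x • nabla S G V i x + pd S s i x • V x := by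
  simp only [nabla, pd_smul hS hs hV, Pi.smul_apply', tensorAct_smul, smul_add]
  abel

variable (S G) in
/-- The Laplacian of a function. -/
def scalarLaplacian (s : Coord d → ℝ) (x : Coord d) : ℝ :=
  ∑ i, ∑ j, (G x)⁻¹ i j * (pd S (pd S s j) i x - ∑ m, christoffel S G m i j x * pd S s m x)

/-- The two mixed terms of the second derivative agree after exchanging the indices, because `g` is
symmetric; this is the factor 2. -/
lemma sum_smul_leibniz {ι E : Type*} [Fintype ι] [AddCommGroup E] [Module ℝ E]
    (g : ι → ι → ℝ) (hg : ∀ i j, g i j = g j i) (Γ : ι → ι → ι → ℝ) (s : ℝ) (v : E)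
    (p : ι → ℝ) (q : ι → ι → ℝ) (N : ι → E) (Q : ι → ι → E) :
    ∑ i, ∑ j, g i j • (s • Q i j + p i • N j + (p j • N i + q i j • v)
        - ∑ m, Γ m i j • (s • N m + p m • v))
      = s • ∑ i, ∑ j, g i j • (Q i j - ∑ m, Γ m i j • N m)
        + (∑ i, ∑ j, g i j * (q i j - ∑ m, Γ m i j * p m)) • v
        + (2 : ℝ) • ∑ i, ∑ j, (g i j * p i) • N j := by
  have h1 : ∑ i, ∑ j, (g i j * p j) • N i = ∑ i, ∑ j, (g i j * p i) • N j := by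
    rw [Finset.sum_comm]
    exact Finset.sum_congr rfl fun i _ => Finset.sum_congr rfl fun j _ => by rw [hg]
  have h2 (i j : ι) : ∑ m, Γ m i j • (s • N m + p m • v)
      = s • ∑ m, Γ m i j • N m + (∑ m, Γ m i j * p m) • v := by
    simp only [smul_add, Finset.sum_add_distrib, Finset.smul_sum, Finset.sum_smul, smul_smul,
      mul_comm s]
  rw [two_smul]
  nth_rewrite 2 [← h1]
  simp only [h2]
  rw [Finset.smul_sum, Finset.sum_smul, ← Finset.sum_add_distrib, ← Finset.sum_add_distrib,
    ← Finset.sum_add_distrib]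
  refine Finset.sum_congr rfl fun i _ => ?_
  rw [Finset.smul_sum, Finset.sum_smul, ← Finset.sum_add_distrib, ← Finset.sum_add_distrib,
    ← Finset.sum_add_distrib]
  refine Finset.sum_congr rfl fun j _ => ?_
  module

/-- The Leibniz rule for the Laplacian of the product of a function with a tractor field. -/
lemma laplacian_smul (hS : UniqueDiffOn ℝ S)
    (hG : ∀ i j, ContDiffOn ℝ ∞ (fun x => G x i j) S) (hdet : ∀ x ∈ S, (G x).det ≠ 0)
    (hsymm : (G x).IsSymm) (hx : x ∈ S) {s : Coord d → ℝ} {V : Coord d → TractorTensor d k}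
    (hs : ∀ᶠ z in 𝓝[S] x, ContDiffWithinAt ℝ ∞ s S z)
    (hV : ∀ᶠ z in 𝓝[S] x, ContDiffWithinAt ℝ ∞ V S z) :
    laplacian S G (s • V) x = s x • laplacian S G V x + scalarLaplacian S G s x • V x
      + (2 : ℝ) • ∑ i, ∑ j, ((G x)⁻¹ i j * pd S s i x) • nabla S G V j x := by
  have hd {F : Type} [NormedAddCommGroup F] [NormedSpace ℝ F] {u : Coord d → F} {z : Coord d}
    (h : ContDiffWithinAt ℝ ∞ u S z) : DifferentiableWithinAt ℝ u S z :=
    h.differentiableWithinAt (by simp)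
  have hsx := hs.self_of_nhdsWithin hx
  have hVx := hV.self_of_nhdsWithin hx
  -- The first-order rule is needed on a neighbourhood within `S`, since the outer derivative
  -- depends on the germ of the inner one.
  have h1 (j : Fin d) : nabla S G (s • V) j =ᶠ[𝓝[S] x] s • nabla S G V j + pd S s j • V := by
    filter_upwards [hs, hV, self_mem_nhdsWithin] with z h1 h2 h3
    exact nabla_smul (hS z h3) (hd h1) (hd h2) j
  have h2 (i j : Fin d) : nabla S G (nabla S G (s • V) j) i x
      = s x • nabla S G (nabla S G V j) i x + pd S s i x • nabla S G V j x
        + (pd S s j x • nabla S G V i x + pd S (pd S s j) i x • V x) := by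
    have hn := hd (ContDiffWithinAt.nabla hS hG hdet hx hVx j)
    have hp := hd (ContDiffWithinAt.pd hS hx hsx j)
    rw [nabla_congr (h1 j) hx, nabla_add (hS x hx) ((hd hsx).smul hn) (hp.smul (hd hVx)),
      nabla_smul (hS x hx) (hd hsx) hn, nabla_smul (hS x hx) hp (hd hVx)]
  have hinv (i j : Fin d) : (G x)⁻¹ i j = (G x)⁻¹ j i := by
    conv_lhs => rw [← hsymm.eq, ← Matrix.transpose_nonsing_inv, Matrix.transpose_apply]
  have h3 (m : Fin d) : nabla S G (s • V) m x = s x • nabla S G V m x + pd S s m x • V x :=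
    (h1 m).eq_of_nhdsWithin hx
  simp only [laplacian, scalarLaplacian, h2, h3]
  exact sum_smul_leibniz (fun i j => (G x)⁻¹ i j) hinv (fun m i j => christoffel S G m i j x) _ _
    (fun i => pd S s i x) (fun i j => pd S (pd S s j) i x) (fun i => nabla S G V i x)
    (fun i j => nabla S G (nabla S G V j) i x)

/-- In rank 0 the tensorial action is an empty sum, so the coupled connection is plain
differentiation. This is how `σ` is treated as a tractor. -/
lemma nabla_rank_zero (hS : UniqueDiffWithinAt ℝ S x) {s : Coord d → ℝ}
    (hs : DifferentiableWithinAt ℝ s S x) (e : TractorTensor d 0) (i : Fin d) :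
    nabla S G (fun z => s z • e) i x = pd S s i x • e := by
  rw [nabla, pd_smul_const hS hs, tensorAct_rank_zero, add_zero]

lemma laplacian_rank_zero (hS : UniqueDiffOn ℝ S) (hx : x ∈ S) {s : Coord d → ℝ}
    (hs : ContDiffOn ℝ ∞ s S) (e : TractorTensor d 0) :
    laplacian S G (fun z => s z • e) x = scalarLaplacian S G s x • e := by
  have h1 : ∀ z ∈ S, ∀ j, nabla S G (fun z => s z • e) j z = pd S s j z • e := fun z hz j =>
    nabla_rank_zero (hS z hz) ((hs z hz).differentiableWithinAt (by simp)) e j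
  have h2 (i j : Fin d) : nabla S G (nabla S G (fun z => s z • e) j) i x
      = pd S (pd S s j) i x • e := by
    rw [nabla_congr (W := fun z => pd S s j z • e)
      (Filter.eventually_of_mem self_mem_nhdsWithin fun z hz => h1 z hz j) hx]
    exact nabla_rank_zero (hS x hx)
      ((ContDiffOn.pd hS hs j x hx).differentiableWithinAt (by simp)) e i
  simp only [laplacian, scalarLaplacian, h2, h1 x hx]
  have h3 {E : Type} [AddCommGroup E] [Module ℝ E] (g : Fin d → Fin d → ℝ)
      (Γ : Fin d → Fin d → Fin d → ℝ) (p : Fin d → ℝ) (q : Fin d → Fin d → ℝ) (e : E) :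
      ∑ i, ∑ j, g i j • (q i j • e - ∑ m, Γ m i j • p m • e)
        = (∑ i, ∑ j, g i j * (q i j - ∑ m, Γ m i j * p m)) • e := by
    simp only [Finset.sum_smul, sub_smul, mul_smul]
  exact h3 (fun i j => (G x)⁻¹ i j) (fun m i j => christoffel S G m i j x) _
    (fun i j => pd S (pd S s j) i x) e

/-- The Christoffel term is of first order and only picks up `s⁻¹`; differentiating `s⁻¹` in the
second derivative gives the gradient square, which later contributes to `I²`. -/
lemma scalarLaplacian_log (hS : UniqueDiffOn ℝ S) (hx : x ∈ S) {s : Coord d → ℝ}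
    (hs : ContDiffOn ℝ ∞ s S) (h0 : s x ≠ 0) :
    scalarLaplacian S G (fun z => Real.log (s z)) x
      = (s x)⁻¹ * scalarLaplacian S G s x
        - (s x)⁻¹ ^ 2 * ∑ i, ∑ j, (G x)⁻¹ i j * (pd S s i x * pd S s j x) := by
  have hd : ∀ z ∈ S, DifferentiableWithinAt ℝ s S z := fun z hz =>
    (hs z hz).differentiableWithinAt (by simp)
  have hne : ∀ᶠ z in 𝓝[S] x, s z ≠ 0 := (hs x hx).continuousWithinAt.eventually_ne h0
  have h1 (j : Fin d) : pd S (fun z => Real.log (s z)) j =ᶠ[𝓝[S] x] s⁻¹ • pd S s j := by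
    filter_upwards [hne, self_mem_nhdsWithin] with z h2 h3
    exact pd_log (hS z h3) (hd z h3) h2 j
  have hi (i : Fin d) : pd S s⁻¹ i x = -((s x)⁻¹ ^ 2 * pd S s i x) := by
    have : HasFDerivWithinAt s⁻¹ (-(s x ^ 2)⁻¹ • fderivWithin ℝ s S x) S x :=
      (hasDerivAt_inv h0).comp_hasFDerivWithinAt x (hd x hx).hasFDerivWithinAt
    simp [pd, this.fderivWithin (hS x hx)]
  have h2 (i j : Fin d) : pd S (pd S (fun z => Real.log (s z)) j) i x
      = (s x)⁻¹ * pd S (pd S s j) i x - (s x)⁻¹ ^ 2 * (pd S s i x * pd S s j x) := by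
    rw [pd_congr (h1 j) hx, pd_smul (hS x hx) ((hd x hx).inv h0)
      ((ContDiffOn.pd hS hs j x hx).differentiableWithinAt (by simp)), hi]
    simp only [Pi.inv_apply, smul_eq_mul]
    ring
  simp only [scalarLaplacian]
  rw [Finset.mul_sum, Finset.mul_sum, ← Finset.sum_sub_distrib]
  refine Finset.sum_congr rfl fun i _ => ?_
  rw [Finset.mul_sum, Finset.mul_sum, ← Finset.sum_sub_distrib]
  refine Finset.sum_congr rfl fun j _ => ?_
  have h3 : ∑ m, christoffel S G m i j x * pd S (fun z => Real.log (s z)) m x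
      = (s x)⁻¹ * ∑ m, christoffel S G m i j x * pd S s m x := by
    rw [Finset.mul_sum]
    refine Finset.sum_congr rfl fun m _ => ?_
    rw [pd_log (hS x hx) (hd x hx) h0]
    ring
  rw [h2, h3]
  ring

end Leibniz

variable {d k : ℕ} {H : Type*} [TopologicalSpace H] {I : ModelWithCorners ℝ (Coord d) H}
  {M : Type*} [TopologicalSpace M] [ChartedSpace H M] [IsManifold I ∞ M]

/-! ### Metrics in a chart -/

lemma real_smul_eq_coe_smul (r : ℝ) (T : TractorTensor d k) : r • T = (r : ℂ) • T := by
  ext; simp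

lemma fromChart_self (p : M) (v : Coord d) : fromChart I p p v = v := by
  have : IsManifold I 1 M := .of_le (n := ∞) (by simp)
  exact tangentCoordChange_self (E := Coord d) (mem_extChartAt_source p)

lemma tangentCoordChange_fromChart {p q : M} (hq : q ∈ (extChartAt I p).source) (v : Coord d) :
    tangentCoordChange I q p q (fromChart I p q v) = v := by
  have : IsManifold I 1 M := .of_le (n := ∞) (by simp)
  exact (tangentCoordChange_comp (E := Coord d) ⟨⟨hq, mem_extChartAt_source q⟩, hq⟩).trans
    (tangentCoordChange_self hq)

lemma fromChart_tangentCoordChange {p q : M} (hq : q ∈ (extChartAt I p).source) (v : Coord d) :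
    fromChart I p q (tangentCoordChange I q p q v) = v := by
  have : IsManifold I 1 M := .of_le (n := ∞) (by simp)
  have hq' := mem_extChartAt_source (I := I) q
  exact (tangentCoordChange_comp (E := Coord d) ⟨⟨hq', hq⟩, hq'⟩).trans
    (tangentCoordChange_self hq')

lemma sum_smul_coordVec (v : Coord d) : ∑ i, v i • coordVec i = v := by
  ext j
  simp [coordVec, Finset.sum_apply, Pi.single_apply]

namespace PseudoMetric

variable (g : PseudoMetric I M)

lemma gram_eq_chartMatrix (p : M) : g.gram p = chartMatrix I g.val p (extChartAt I p p) := by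
  -- The base point occurs in the types of tangent vectors, so it is generalised to `q` before being
  -- identified with `p`.
  have h : ∀ q, q = p → ∀ i j, g.val p (coordVec i : Coord d) (coordVec j : Coord d)
      = g.val q (fromChart I p q (coordVec i)) (fromChart I p q (coordVec j)) := by
    rintro q rfl i j
    rw [fromChart_self, fromChart_self]
  ext i j
  exact h _ (extChartAt_to_inv p) i j

lemma isSymm_chartMatrix (p : M) (x : Coord d) : (chartMatrix I g.val p x).IsSymm := by
  ext i j
  exact g.symm _ _ _

/-- A kernel vector of the matrix is carried by `fromChart` to the radical of the metric:
surjectivity of `fromChart` tests it against all tangent vectors, and injectivity brings its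
vanishing back to the chart. -/
lemma det_chartMatrix_ne_zero (p : M) {x : Coord d} (hx : x ∈ (extChartAt I p).target) :
    (chartMatrix I g.val p x).det ≠ 0 := by
  rw [Ne, ← Matrix.exists_mulVec_eq_zero_iff]
  rintro ⟨v, hv, h⟩
  set q := (extChartAt I p).symm x with hq
  have hqs : q ∈ (extChartAt I p).source := (extChartAt I p).map_target hx
  let v' : Coord d := WithLp.toLp 2 v
  let b : Coord d →L[ℝ] Coord d →L[ℝ] ℝ := g.val q
  let A : Coord d →L[ℝ] Coord d := fromChart I p q
  have h1 (i : Fin d) : b (A (coordVec i)) (A v') = 0 := by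
    have h2 : ∑ j, b (A (coordVec i)) (A (coordVec j)) * v j = 0 := congrFun h i
    rw [← h2, ← sum_smul_coordVec v', map_sum, map_sum]
    exact Finset.sum_congr rfl fun j _ => by simp [v', mul_comm]
  have h2 (u : Coord d) : b (A u) (A v') = 0 := by
    rw [← sum_smul_coordVec u]
    simp [h1]
  have h3 : A v' = 0 := by
    refine g.nondegenerate q _ fun u => ?_
    have h3 := h2 (tangentCoordChange I q p q u)
    rw [show A (tangentCoordChange I q p q u) = u from fromChart_tangentCoordChange hqs u] at h3
    exact (g.symm q _ _).trans h3
  have h4 : v' = 0 := by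
    rw [← tangentCoordChange_fromChart hqs v']
    exact (congrArg _ h3).trans (map_zero _)
  exact hv (congrArg WithLp.ofLp h4)

lemma rescale_mem_conformalClass {g₀ g : PseudoMetric I M} (hg : g ∈ g₀.conformalClass)
    (Υ : C^∞⟮I, M; 𝓘(ℝ), ℝ⟯) : g.rescale Υ ∈ g₀.conformalClass := by
  obtain ⟨Ω, rfl⟩ := hg
  refine ⟨Υ + Ω, PseudoMetric.ext (funext fun p => ?_)⟩
  simp only [rescale, smul_smul, ← Real.exp_add, ContMDiffMap.coe_add, Pi.add_apply, mul_add]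

/-! ### The weight operator -/

omit [IsManifold I ∞ M] in
lemma const_apply (s : ℝ) (p : M) : (ContMDiffMap.const s : C^∞⟮I, M; 𝓘(ℝ), ℝ⟯) p = s := rfl

/-- For constant `Υ` the terms in `dΥ` vanish and the splitting changes only by the scaling of each
slot. -/
lemma dualChange_const (s : ℝ) (p : M) (α : DualTractor d) :
    g.dualChange (ContMDiffMap.const s) p α
      = (Real.exp s * α.1, Real.exp s • α.2.1, Real.exp (-s) * α.2.2) := by
  have h : differential (I := I) (ContMDiffMap.const s) p = 0 := mfderiv_const
  have h' : g.gradient (ContMDiffMap.const s) p = 0 := by simp [gradient, h]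
  simp [dualChange, h, h', const_apply]

lemma changeSplitting_const_neg (g' : PseudoMetric I M) (s : ℝ) (p : M) (t : TractorTensor d k) :
    g'.changeSplitting (ContMDiffMap.const (-s)) p
      (g.changeSplitting (ContMDiffMap.const s) p t) = t := by
  ext α
  simp only [changeSplitting, ContinuousMultilinearMap.compContinuousLinearMap_apply]
  congr 1
  ext1 i
  rw [dualChange_const, dualChange_const]
  simp [← mul_assoc, smul_smul, ← Real.exp_add]

end PseudoMetric

/-- The weight operator on a family whose values are, up to a factor, equivariant along constant
rescalings. -/
lemma weightOp_of_rescale {V : Family I M k} {g : PseudoMetric I M} {p : M}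
    {t : TractorTensor d k} {a : ℝ → ℂ} {a' : ℂ} (ha : HasDerivAt a a' 0)
    (hV : ∀ s : ℝ, V (g.rescale (ContMDiffMap.const s)) p
      = a s • g.changeSplitting (ContMDiffMap.const s) p t) :
    weightOp V g p = a' • t := by
  have h : (fun s : ℝ => (g.rescale (ContMDiffMap.const s)).changeSplitting
      (ContMDiffMap.const (-s)) p (V (g.rescale (ContMDiffMap.const s)) p))
      = fun s => a s • t := by
    funext s
    rw [hV]
    conv_rhs => rw [← g.changeSplitting_const_neg (g.rescale (ContMDiffMap.const s)) s p t]
    rfl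
  rw [weightOp, h]
  exact (ha.smul_const t).deriv

/-- Along `e^{2s} g` the factor `exp (w s)` comes from the weight of `f`, and `e s` from the shift
of `log σ` by `s`. -/
lemma hasDerivAt_affine_mul_exp (b e w : ℂ) :
    HasDerivAt (fun s : ℝ => (b + e * s) * Complex.exp (w * s)) (w * b + e) 0 := by
  have h1 : HasDerivAt (fun s : ℝ => (s : ℂ)) 1 0 := Complex.ofRealCLM.hasDerivAt
  have h := ((h1.const_mul e).const_add b).mul (h1.const_mul w).cexp
  refine h.congr_deriv ?_
  simp
  ring

section

variable {c : Set (PseudoMetric I M)}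
  (hc : ∀ g ∈ c, ∀ Υ : C^∞⟮I, M; 𝓘(ℝ), ℝ⟯, g.rescale Υ ∈ c)
  {σ : RealFamily I M} (hσ : IsScale c σ)
include hc hσ

/-- The families `(b + e log σ) f` are stable under `𝐰`, which sends `(b, e)` to `(w b + e, w e)`.
Hence the lemma applies to its own output and also gives `𝐰²`. -/
lemma weightOp_log_smul {U : Set M} {w : ℂ} {f V : Family I M k}
    (hf : IsWeightedTractor c w U f) {p : M} (hp : p ∈ U) (hpos : ∀ g ∈ c, 0 < σ g p)
    (b e : ℂ) (hV : ∀ g ∈ c, V g p = (b + e * Real.log (σ g p)) • f g p)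
    (g : PseudoMetric I M) (hg : g ∈ c) :
    weightOp V g p = ((w * b + e) + (w * e) * Real.log (σ g p)) • f g p := by
  refine (weightOp_of_rescale (hasDerivAt_affine_mul_exp (b + e * Real.log (σ g p)) e w)
    (fun s => ?_)).trans (by congr 1; ring)
  rw [hV _ (hc g hg _), hσ.equivariant g hg, hf.equivariant g hg _ p hp, smul_smul,
    Real.log_mul (Real.exp_ne_zero _) (hpos g hg).ne', Real.log_exp,
    PseudoMetric.const_apply]
  congr 1
  push_cast
  ring

lemma weightOp_smul_toFamily {V : Family I M 0} {p : M} (b : ℂ)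
    (hV : ∀ g ∈ c, V g p = b • toFamily σ g p) (g : PseudoMetric I M) (hg : g ∈ c) :
    weightOp V g p = b • toFamily σ g p := by
  refine (weightOp_of_rescale (hasDerivAt_affine_mul_exp b 0 1) (fun s => ?_)).trans
    (by congr 1; ring)
  rw [hV _ (hc g hg _)]
  ext
  simp [toFamily, hσ.equivariant g hg, PseudoMetric.changeSplitting, PseudoMetric.const_apply]
  ring

end

/-! ### The scale tractor and the Thomas-D operator in a chart -/

section Chart

variable {c : Set (PseudoMetric I M)}
  (hc : ∀ g ∈ c, ∀ Υ : C^∞⟮I, M; 𝓘(ℝ), ℝ⟯, g.rescale Υ ∈ c)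
  {σ : RealFamily I M} (hσ : IsScale c σ)

lemma contDiffOn_scale {σ : RealFamily I M} (hσ : IsScale c σ) {g : PseudoMetric I M}
    (hg : g ∈ c) (p : M) :
    ContDiffOn ℝ ∞ (fun x => σ g ((extChartAt I p).symm x)) (extChartAt I p).target := by
  rw [← contMDiffOn_iff_contDiffOn]
  exact (hσ.smooth g hg).comp_contMDiffOn (contMDiffOn_extChartAt_symm p)

omit [IsManifold I ∞ M] in
lemma eventually_mem_chart {U : Set M} (hU : IsOpen U) {p : M} (hp : p ∈ U) :
    ∀ᶠ x in 𝓝[(extChartAt I p).target] (extChartAt I p p),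
      x ∈ (extChartAt I p).target ∩ (extChartAt I p).symm ⁻¹' U := by
  have h := continuousOn_extChartAt_symm (I := I) p _ (mem_extChartAt_target p)
  have h' := h.preimage_mem_nhdsWithin (t := U) (by
    rw [extChartAt_to_inv]; exact hU.mem_nhds hp)
  exact Filter.inter_mem self_mem_nhdsWithin h'

/-- Smoothness is given within the part of the chart over `U`; as `U` is open, this agrees near the
point with smoothness within the whole chart domain. -/
lemma eventually_contDiffWithinAt_chartField {w : ℂ} {U : Set M} (hU : IsOpen U)
    {f : Family I M k} (hf : IsWeightedTractor c w U f) {g : PseudoMetric I M} (hg : g ∈ c)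
    {p : M} (hp : p ∈ U) :
    ∀ᶠ x in 𝓝[(extChartAt I p).target] (extChartAt I p p),
      ContDiffWithinAt ℝ ∞ (chartField I (f g) p) (extChartAt I p).target x := by
  have h := eventually_mem_chart (I := I) hU hp
  filter_upwards [eventually_eventually_nhdsWithin.2 h, h] with x hx hx'
  exact (hf.smooth g hg p x hx').mono_of_mem_nhdsWithin hx

lemma chartField_toFamily (σ : RealFamily I M) (g : PseudoMetric I M) (p : M) :
    chartField I (toFamily σ g) p = fun x => σ g ((extChartAt I p).symm x) •
      ContinuousMultilinearMap.constOfIsEmpty ℝ (fun _ => DualTractor d) (1 : ℂ) := by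
  ext x
  simp [chartField, toFamily]

lemma chartField_const_smul (a : ℂ) (v : M → TractorTensor d k) (p : M) :
    chartField I (a • v) p = a • chartField I v p := rfl

lemma chartField_add (v v' : M → TractorTensor d k) (p : M) :
    chartField I (v + v') p = chartField I v p + chartField I v' p := rfl

lemma chartField_logXOp (σ : RealFamily I M) (f : Family I M k) (g : PseudoMetric I M) (p : M) :
    chartField I (logXOp σ f g) p
      = (fun x => Real.log (σ g ((extChartAt I p).symm x))) • chartField I (f g) p := rfl

/-- Weights are known only over `U`, while the middle slot of `D` differentiates `(d + 2𝐰 - 2) V`;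
equality over the open set `U` suffices for that. -/
lemma chartField_congr {U : Set M} (hU : IsOpen U) {v v' : M → TractorTensor d k}
    (h : ∀ q ∈ U, v q = v' q) {p : M} (hp : p ∈ U) :
    chartField I v p =ᶠ[𝓝[(extChartAt I p).target] (extChartAt I p p)] chartField I v' p := by
  filter_upwards [eventually_mem_chart (I := I) hU hp] with x hx
  rw [chartField, chartField, h _ hx.2]

include hc hσ

/-- Since `σ` has weight 1, the factor `d + 2𝐰 - 2` equals `d` and cancels `1/d` in the top and
middle slots; in the bottom slot `1/d` remains. -/
lemma scaleTractor_eq (hd : d ≠ 0) {g : PseudoMetric I M} (hg : g ∈ c) (p : M) :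
    scaleTractor σ g p =
      { top := σ g p
        mid := fun i => ((pd (extChartAt I p).target
          (fun x => σ g ((extChartAt I p).symm x)) i (extChartAt I p p) : ℝ) : ℂ)
        bot := -(1 / (d : ℂ)) * (scalarLaplacian (extChartAt I p).target (chartMatrix I g.val p)
          (fun x => σ g ((extChartAt I p).symm x)) (extChartAt I p p) + traceJ g p * σ g p) } := by
  have hd' : (d : ℂ) ≠ 0 := Nat.cast_ne_zero.2 hd
  have h1 : ∀ q, ∀ g ∈ c, weightOp (toFamily σ) g q = (1 : ℂ) • toFamily σ g q := fun q =>
    weightOp_smul_toFamily hc hσ 1 fun _ _ => (one_smul _ _).symm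
  have h2 : weightOp (weightOp (toFamily σ)) g p = (1 : ℂ) • toFamily σ g p :=
    weightOp_smul_toFamily hc hσ 1 (h1 p) g hg
  have h3 : (hOp (toFamily σ) - (2 : ℂ) • toFamily σ) g = (d : ℂ) • toFamily σ g := by
    funext q
    simp [hOp, h1 q g hg]
  have hs := contDiffOn_scale hσ hg p
  have hx := mem_extChartAt_target (I := I) p
  have hS := uniqueDiffOn_extChartAt_target (I := I) p
  have hdiff := (hs _ hx).differentiableWithinAt (by simp)
  have h0 (v : Fin 0 → DualTractor d) : toFamily σ g p v = σ g p := rfl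
  simp only [scaleTractor, thomasD, Slots.mk.injEq]
  refine ⟨?_, funext fun i => ?_, ?_⟩
  · simp [hOp, h1 p g hg, h2, h0, hd']
  · rw [covDeriv, h3, chartField_const_smul, chartField_toFamily,
      nabla_const_smul (hS _ hx) _ (hdiff.smul_const _), nabla_rank_zero (hS _ hx) hdiff]
    simp [hd']
  · rw [boxOp, chartField_toFamily, laplacian_rank_zero hS hx hs, h1 p g hg]
    simp [h0, mul_comm, add_comm]
    ring

/-- The Leibniz rule for the Thomas-D operator and the log density `log σ`. -/
lemma thomasD_logXOp {w : ℂ} {U : Set M} (hU : IsOpen U) (hpos : ∀ g ∈ c, ∀ p ∈ U, 0 < σ g p)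
    {f : Family I M k} (hf : IsWeightedTractor c w U f) {g : PseudoMetric I M} (hg : g ∈ c)
    {p : M} (hp : p ∈ U) :
    ∃ (N : Fin d → TractorTensor d k) (Λ : TractorTensor d k) (s' : Fin d → ℝ) (s'' : ℝ),
      s' = (fun i => pd (extChartAt I p).target
          (fun x => σ g ((extChartAt I p).symm x)) i (extChartAt I p p)) ∧
      s'' = scalarLaplacian (extChartAt I p).target (chartMatrix I g.val p)
          (fun x => σ g ((extChartAt I p).symm x)) (extChartAt I p p) ∧
      thomasD f g p =
        { top := ((d + 2 * w - 2) * w) • f g p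
          mid := fun i => (d + 2 * w - 2) • N i
          bot := -(Λ + (traceJ g p * w) • f g p) } ∧
      thomasD (logXOp σ f) g p =
        { top := ((d + 2 * w - 2) * w * Real.log (σ g p) + (d + 4 * w - 2)) • f g p
          mid := fun i => (d + 2 * w - 2) •
              ((Real.log (σ g p) : ℂ) • N i + ((σ g p : ℂ)⁻¹ * s' i) • f g p)
            + (2 : ℂ) • N i
          bot := -((Real.log (σ g p) : ℂ) • Λ
            + ((σ g p : ℂ)⁻¹ * s'' - (σ g p : ℂ)⁻¹ ^ 2 *
              ∑ i, ∑ j, ((g.gram p)⁻¹ i j : ℂ) * (s' i * s' j)) • f g p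
            + (2 : ℂ) • ∑ i, ∑ j, (((g.gram p)⁻¹ i j : ℂ) * ((σ g p : ℂ)⁻¹ * s' i)) • N j
            + (traceJ g p * (1 + w * Real.log (σ g p))) • f g p) } := by
  have hs := contDiffOn_scale hσ hg p
  have hx := mem_extChartAt_target (I := I) p
  have hS := uniqueDiffOn_extChartAt_target (I := I) p
  have hpos' : ∀ q ∈ U, ∀ g ∈ c, 0 < σ g q := fun q hq g hg => hpos g hg q hq
  -- The coefficient pairs `(b, e)` used below are `(1, 0)` for `f`, `(w, 0)` for `𝐰 f`, `(0, 1)`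
  -- for `log σ f` and `(1, w)` for `𝐰 (log σ f)`.
  have hw (q : M) (hq : q ∈ U) (V : Family I M k) :=
    weightOp_log_smul (V := V) hc hσ hf hq (hpos' q hq)
  have hf1 : ∀ q ∈ U, ∀ g ∈ c, weightOp f g q = w • f g q := fun q hq g hg => by
    simpa using hw q hq f 1 0 (fun _ _ => by simp) g hg
  have hf2 : weightOp (weightOp f) g p = (w * w) • f g p := by
    simpa using hw p hp _ w 0 (fun g hg => by simpa using hf1 p hp g hg) g hg
  have hl1 : ∀ q ∈ U, ∀ g ∈ c, weightOp (logXOp σ f) g q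
      = (1 + w * Real.log (σ g q)) • f g q := fun q hq g hg => by
    simpa using hw q hq (logXOp σ f) 0 1
      (fun g _ => by simp [logXOp, real_smul_eq_coe_smul]) g hg
  have hl2 : weightOp (weightOp (logXOp σ f)) g p
      = ((w + w) + (w * w) * Real.log (σ g p)) • f g p := by
    simpa using hw p hp _ 1 w (hl1 p hp) g hg
  have hl0 (q : M) : logXOp σ f g q = (Real.log (σ g q) : ℂ) • f g q :=
    real_smul_eq_coe_smul _ _
  have hm1 : ∀ q ∈ U, (hOp f - (2 : ℂ) • f) g q = ((d + 2 * w - 2) • f g) q := fun q hq => by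
    simp only [hOp, Pi.sub_apply, Pi.add_apply, Pi.smul_apply, hf1 q hq g hg]
    module
  have hm2 : ∀ q ∈ U, (hOp (logXOp σ f) - (2 : ℂ) • logXOp σ f) g q
      = ((d + 2 * w - 2) • logXOp σ f g + (2 : ℂ) • f g) q := fun q hq => by
    simp only [hOp, Pi.sub_apply, Pi.add_apply, Pi.smul_apply, hl1 q hq g hg, hl0]
    module
  have hfe := eventually_contDiffWithinAt_chartField hU hf hg hp
  have hfd := (hfe.self_of_nhdsWithin hx).differentiableWithinAt (by simp)
  have hσp : σ g ((extChartAt I p).symm (extChartAt I p p)) = σ g p := by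
    rw [extChartAt_to_inv]
  have hfp : chartField I (f g) p (extChartAt I p p) = f g p := by
    have h : ∀ q, q = p → (f g q).compContinuousLinearMap (fun _ =>
        (ContinuousLinearMap.id ℝ ℝ).prodMap
          (ContinuousLinearMap.prodMap (fromChart I p q) (ContinuousLinearMap.id ℝ ℝ)))
        = f g p := by
      rintro q rfl
      ext α
      simp only [ContinuousMultilinearMap.compContinuousLinearMap_apply]
      congr 1
      ext1 i
      exact Prod.ext rfl (Prod.ext (fromChart_self q _) rfl)
    exact h _ (extChartAt_to_inv p)
  have hne : σ g ((extChartAt I p).symm (extChartAt I p p)) ≠ 0 := by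
    rw [hσp]; exact (hpos g hg p hp).ne'
  have hle : ∀ᶠ x in 𝓝[(extChartAt I p).target] (extChartAt I p p), ContDiffWithinAt ℝ ∞
      (fun x => Real.log (σ g ((extChartAt I p).symm x))) (extChartAt I p).target x := by
    filter_upwards [eventually_mem_chart (I := I) hU hp] with x hx'
    exact (hs x hx'.1).log (hpos g hg _ hx'.2).ne'
  have hld := (hle.self_of_nhdsWithin hx).differentiableWithinAt (by simp)
  have hsd := (hs _ hx).differentiableWithinAt (by simp)
  -- `N = ∇f` and `Λ = Δf`. The later algebra uses only that the same `N` and `Λ` occur in both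
  -- expressions.
  refine ⟨fun i => nabla (extChartAt I p).target (chartMatrix I g.val p) (chartField I (f g) p) i
    (extChartAt I p p), boxOp f g p, _, _, rfl, rfl, ?_, ?_⟩
  · simp only [thomasD, Slots.mk.injEq]
    refine ⟨?_, funext fun i => ?_, ?_⟩
    · simp only [hOp, Pi.sub_apply, Pi.add_apply, Pi.smul_apply, hf1 p hp g hg, hf2]
      module
    · rw [covDeriv, nabla_congr (chartField_congr hU hm1 hp) hx, chartField_const_smul,
        nabla_const_smul (hS _ hx) _ hfd]
    · rw [hf1 p hp g hg, real_smul_eq_coe_smul, smul_smul]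
  · simp only [thomasD, Slots.mk.injEq]
    refine ⟨?_, funext fun i => ?_, ?_⟩
    · simp only [hOp, Pi.sub_apply, Pi.add_apply, Pi.smul_apply, hl1 p hp g hg, hl2]
      module
    · rw [covDeriv, nabla_congr (chartField_congr hU hm2 hp) hx, chartField_add,
        chartField_const_smul, chartField_const_smul, chartField_logXOp,
        nabla_add (hS _ hx) ((hld.smul hfd).const_smul _) (hfd.const_smul _),
        nabla_const_smul (hS _ hx) _ (hld.smul hfd), nabla_const_smul (hS _ hx) _ hfd,
        nabla_smul (hS _ hx) hld hfd, pd_log (hS _ hx) hsd hne, hfp, hσp, real_smul_eq_coe_smul,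
        real_smul_eq_coe_smul]
      push_cast
      rfl
    · rw [boxOp, chartField_logXOp, laplacian_smul hS (g.smooth p)
        (fun x hx => g.det_chartMatrix_ne_zero p hx) (g.isSymm_chartMatrix p _) hx hle hfe,
        scalarLaplacian_log hS hx hs hne, hl1 p hp g hg, hfp, hσp, g.gram_eq_chartMatrix]
      simp only [real_smul_eq_coe_smul, pd_log (hS _ hx) hsd hne, hσp, smul_smul]
      push_cast
      rfl

end Chart

/-! ### Contraction with the scale tractor, and the commutator. -/

/-- The algebraic identity behind the commutator `[I·D, log σ]`: `F` is the value of the weighted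
tractor, `N` its covariant derivative, `Λ` its Laplacian. -/
lemma contract_sub_log_smul_contract {W : Type*} [AddCommGroup W] [Module ℂ W]
    (g : PseudoMetric I M) (p : M) (hd : (d : ℂ) ≠ 0) (w J s s'' L : ℂ) (hs : s ≠ 0)
    (s' : Fin d → ℂ) (F Λ : W) (N : Fin d → W) (T : Slots d ℂ)
    (hT : T = { top := s, mid := s', bot := -(1 / (d : ℂ)) * (s'' + J * s) }) :
    contract g p T
        { top := ((d + 2 * w - 2) * w * L + (d + 4 * w - 2)) • F
          mid := fun i => (d + 2 * w - 2) • (L • N i + (s⁻¹ * s' i) • F) + (2 : ℂ) • N i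
          bot := -(L • Λ
            + (s⁻¹ * s'' - s⁻¹ ^ 2 *
              ∑ i, ∑ j, ((g.gram p)⁻¹ i j : ℂ) * (s' i * s' j)) • F
            + (2 : ℂ) • ∑ i, ∑ j, (((g.gram p)⁻¹ i j : ℂ) * (s⁻¹ * s' i)) • N j
            + (J * (1 + w * L)) • F) }
      - L • contract g p T
        { top := ((d + 2 * w - 2) * w) • F
          mid := fun i => (d + 2 * w - 2) • N i
          bot := -(Λ + (J * w) • F) }
      = ((d + 2 * w - 1) * s⁻¹ * contract g p T T) • F := by
  set γ : Fin d → Fin d → ℂ := fun i j => ((g.gram p)⁻¹ i j : ℂ) with hγ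
  have h1 : ∑ i, ∑ j, γ i j • s' i •
        ((d + 2 * w - 2) • (L • N j + (s⁻¹ * s' j) • F) + (2 : ℂ) • N j)
      = ((d + 2 * w - 2) * L + 2) • ∑ i, ∑ j, (γ i j * s' i) • N j
        + ((d + 2 * w - 2) * s⁻¹ * ∑ i, ∑ j, γ i j * (s' i * s' j)) • F := by
    simp only [Finset.smul_sum, Finset.mul_sum, Finset.sum_smul, ← Finset.sum_add_distrib]
    refine Finset.sum_congr rfl fun i _ => Finset.sum_congr rfl fun j _ => ?_
    module
  have h2 : ∑ i, ∑ j, γ i j • s' i • (d + 2 * w - 2) • N j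
      = (d + 2 * w - 2) • ∑ i, ∑ j, (γ i j * s' i) • N j := by
    simp only [Finset.smul_sum]
    refine Finset.sum_congr rfl fun i _ => Finset.sum_congr rfl fun j _ => ?_
    module
  have h3 : ∑ i, ∑ j, (γ i j * (s⁻¹ * s' i)) • N j
      = s⁻¹ • ∑ i, ∑ j, (γ i j * s' i) • N j := by
    simp only [Finset.smul_sum]
    refine Finset.sum_congr rfl fun i _ => Finset.sum_congr rfl fun j _ => ?_
    module
  subst hT
  simp only [contract]
  have h1' := h1
  have h2' := h2
  simp only [hγ] at h1' h2' h3
  rw [h1', h2', h3]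
  simp only [smul_eq_mul]
  generalize ∑ i, ∑ j, (((g.gram p)⁻¹ i j : ℝ) * s' i : ℂ) • N j = A
  generalize ∑ i, ∑ j, (((g.gram p)⁻¹ i j : ℝ) * (s' i * s' j) : ℂ) = Q
  -- `A` is `⟨dσ, ∇f⟩`: its surplus 2 from the middle slot cancels `s · (-2 s⁻¹)` from the bottom
  -- slot. In the coefficient of `F`, `1 + (d + 4w - 2)/d = 2 (d + 2w - 1)/d` produces the common
  -- factor `d + 2w - 1`.
  match_scalars <;> field_simp <;> ring

/-- The commutator `[y, log x] = -x⁻¹ (h - 1)` on weighted tractors. -/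
lemma commutator_yOp_logXOp (hd : d ≠ 0) {c : Set (PseudoMetric I M)}
    (hc : ∀ g ∈ c, ∀ Υ : C^∞⟮I, M; 𝓘(ℝ), ℝ⟯, g.rescale Υ ∈ c)
    {σ : RealFamily I M} (hσ : IsScale c σ) (hI : ∀ g ∈ c, ∀ p : M, scaleSq σ g p ≠ 0)
    {U : Set M} (hU : IsOpen U) (hpos : ∀ g ∈ c, ∀ p ∈ U, 0 < σ g p)
    {w : ℂ} {f : Family I M k} (hf : IsWeightedTractor c w U f)
    {g : PseudoMetric I M} (hg : g ∈ c) {p : M} (hp : p ∈ U) :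
    commutator (yOp σ) (logXOp σ) f g p = -(xInvOp σ (hOp f - f)) g p := by
  have hne := (hpos g hg p hp).ne'
  have hI' := hI g hg p
  have hw : weightOp f g p = w • f g p := by
    simpa using weightOp_log_smul hc hσ hf hp (fun g hg => hpos g hg p hp) 1 0 (V := f)
      (fun _ _ => by simp) g hg
  obtain ⟨N, Λ, s', s'', hs', hs'', hD, hDl⟩ := thomasD_logXOp hc hσ hU hpos hf hg hp
  have hT := scaleTractor_eq hc hσ hd hg p
  rw [← hs''] at hT
  have hT' : scaleTractor σ g p =
      { top := σ g p
        mid := fun i => (s' i : ℂ)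
        bot := -(1 / (d : ℂ)) * (s'' + traceJ g p * σ g p) } := by
    rw [hs']; exact hT
  have key := contract_sub_log_smul_contract g p (Nat.cast_ne_zero.2 hd) w (traceJ g p) (σ g p)
    s'' (Real.log (σ g p)) (Complex.ofReal_ne_zero.2 hne) (fun i => (s' i : ℂ)) (f g p) Λ N _ hT'
  rw [← hD, ← hDl] at key
  have hl : commutator (yOp σ) (logXOp σ) f g p = -(1 / scaleSq σ g p) •
      (contract g p (scaleTractor σ g p) (thomasD (logXOp σ f) g p)
        - (Real.log (σ g p) : ℂ) • contract g p (scaleTractor σ g p) (thomasD f g p)) := by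
    have h : logXOp σ (yOp σ f) g p = (Real.log (σ g p) : ℂ) • yOp σ f g p :=
      real_smul_eq_coe_smul _ _
    simp only [commutator, Pi.sub_apply, h, yOp, iDotD]
    module
  have hr : (-(xInvOp σ (hOp f - f))) g p = -((σ g p : ℂ)⁻¹ • ((d + 2 * w - 1) • f g p)) := by
    simp only [Pi.neg_apply, xInvOp, hOp, Pi.sub_apply, Pi.add_apply, Pi.smul_apply, hw,
      real_smul_eq_coe_smul]
    push_cast
    module
  rw [hl, key]
  refine Eq.trans ?_ hr.symm
  -- The contraction of the scale tractor with itself is `I²` by definition, so it cancels the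
  -- denominator of `y`.
  change _ • ((_ * scaleSq σ g p) • _) = _
  match_scalars
  field_simp

end ConformalTractor

end

theorem proposition6p1 {d : ℕ} (hd : 3 ≤ d)
    {H : Type*} [TopologicalSpace H] (I : ModelWithCorners ℝ (EuclideanSpace ℝ (Fin d)) H)
    {M : Type*} [TopologicalSpace M] [ChartedSpace H M] [IsManifold I ∞ M]
    (c : Set (ConformalTractor.PseudoMetric I M))
    (hc : ∃ g₀ : ConformalTractor.PseudoMetric I M, c = g₀.conformalClass)
    (σ : ConformalTractor.RealFamily I M) (hσ : ConformalTractor.IsScale c σ)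
    (hI : ∀ g ∈ c, ∀ p : M, ConformalTractor.scaleSq σ g p ≠ 0)
    (U : Set M) (hU : IsOpen U) (hpos : ∀ g ∈ c, ∀ p ∈ U, 0 < σ g p)
    (k : ℕ) (w : ℂ) (f : ConformalTractor.Family I M k)
    (hf : ConformalTractor.IsWeightedTractor c w U f) :
    ∀ g ∈ c, ∀ p ∈ U,
      ConformalTractor.commutator (ConformalTractor.yOp σ) (ConformalTractor.logXOp σ) f g p
        = -(ConformalTractor.xInvOp σ (ConformalTractor.hOp f - f)) g p := by
  obtain ⟨g₀, rfl⟩ := hc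
  intro g hg p hp
  exact ConformalTractor.commutator_yOp_logXOp (by omega)
    (fun _ => ConformalTractor.PseudoMetric.rescale_mem_conformalClass) hσ hI hU hpos hf hg hp
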